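/- Let $X=\widehat{\mathbb{Q}^2}$ be the Pontryagin dual of the discrete abelian group $\mathbb{Q}^2$, a compact group equipped with its normalized Haar measure, and let $SL_2(\mathbb{Q})$ act on $X$ by $\langle g\chi, v\rangle=\langle \chi, g^{-1}v\rangle$ for $g\in SL_2(\mathbb{Q})$, $\chi\in X$, $v\in\mathbb{Q}^2$. Let $Y$ be the quotient of $X$ by the relation $\phi\sim\phi'$, where $\phi'(v):=\phi(-v)$, with the quotient Borel structure and the image $\mu$ of the Haar measure. The action of $SL_2(\mathbb{Q})$ on $X$ induces an action of $PSL_2(\mathbb{Q})=SL_2(\mathbb{Q})/\{\pm 1\}$ on $Y$. Then the action $PSL_2(\mathbb{Q})\curvearrowright (Y,\mu)$ is probability-measure preserving and it is 1. (essentially) free: for every $g\neq 1$ in $PSL_2(\mathbb{Q})$, $gy\neq y$ for $\mu$-a.e. $y\in Y$; 2. weakly mixing: for every finite collection $\Omega$ of measurable subsets of $Y$ and every $\varepsilon>0$ there is $s\in PSL_2(\mathbb{Q})$ such that $|\mu(sA\cap B)-\mu(A)\mu(B)|<\varepsilon$ for all $A,B\in\Omega$; 3. prime, i.e. it has no non-trivial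 quotient actions: if $PSL_2(\mathbb{Q})\curvearrowright (Z,\nu)$ is a probability-measure-preserving action on a standard Borel probability space and $p:Y\to Z$ is a measure-preserving map with $p(gy)=gp(y)$ for every $g$ and $\mu$-a.e. $y$, then either $\nu$ is concentrated at a single point, or $p$ is an isomorphism modulo null sets. -/

import Mathlib

open MeasureTheory
open scoped MatrixGroups

universe u v w

/-! ## Probability-measure-preserving actions -/

section PMP

variable (G : Type v) {Y : Type w} [Group G] [MulAction G Y] [MeasurableSpace Y]

/-- The action of `G` on `(Y, μ)` is p.m.p. (probability-measure preserving). -/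
structure IsPMPAction (μ : Measure Y) : Prop where
  isProbabilityMeasure : IsProbabilityMeasure μ
  measurePreserving : ∀ g : G, MeasurePreserving (fun y : Y => g • y) μ μ

/-- (Essential) freeness of an action on a measure space: every `g ≠ 1` moves almost every point. -/
def IsFreeAction (μ : Measure Y) : Prop :=
  ∀ g : G, g ≠ 1 → ∀ᵐ y ∂μ, g • y ≠ y

/-- Weak mixing: for every finite collection `Ω` of measurable sets and every `ε > 0` there is
`s ∈ G` with `|μ (sA ∩ B) - μ A * μ B| < ε` for all `A, B ∈ Ω`. -/
def IsWeaklyMixingAction (μ : Measure Y) : Prop :=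
  ∀ Ω : Set (Set Y), Ω.Finite → (∀ A ∈ Ω, MeasurableSet A) → ∀ ε : ℝ, 0 < ε →
    ∃ s : G, ∀ A ∈ Ω, ∀ B ∈ Ω,
      |μ.real (((fun y : Y => s • y) '' A) ∩ B) - μ.real A * μ.real B| < ε

/-- `p : Y → Z` exhibits the p.m.p. action of `G` on `(Z, ν)` as a quotient action of the action of
`G` on `(Y, μ)`: it is measure preserving and equivariant almost everywhere. -/
structure IsQuotientAction {Z : Type*} [MulAction G Z] [MeasurableSpace Z]
    (μ : Measure Y) (ν : Measure Z) (p : Y → Z) : Prop where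
  isPMPAction : IsPMPAction G ν
  measurePreserving : MeasurePreserving p μ ν
  equivariant : ∀ g : G, ∀ᵐ y ∂μ, p (g • y) = g • p y

/-- `p : (Y, μ) → (Z, ν)` is an isomorphism modulo null sets. -/
def IsIsoModNull {Z : Type*} [MeasurableSpace Z] (μ : Measure Y) (ν : Measure Z)
    (p : Y → Z) : Prop :=
  MeasurePreserving p μ ν ∧ ∃ q : Z → Y, MeasurePreserving q ν μ ∧
    (∀ᵐ y ∂μ, q (p y) = y) ∧ (∀ᵐ z ∂ν, p (q z) = z)

/-- Primeness: there is no non-trivial quotient action. That is, every quotient action on a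
standard Borel probability space `(Z, ν)` is either the one-point action modulo null sets
(`ν` is concentrated at a point), or the action on `(Y, μ)` itself (the quotient map is an
isomorphism modulo null sets). -/
def IsPrimeAction (μ : Measure Y) : Prop :=
  ∀ (Z : Type u) [MeasurableSpace Z] [StandardBorelSpace Z] [MulAction G Z] (ν : Measure Z)
    (p : Y → Z), IsQuotientAction G μ ν p →
      (∃ z₀ : Z, ∀ᵐ z ∂ν, z = z₀) ∨ IsIsoModNull μ ν p

end PMP

/-! ## The action of `PSL₂(ℚ)` on the quotient `Y` of the Pontryagin dual of `ℚ²` -/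

noncomputable section

/-- The discrete abelian group `ℚ²` (a synonym, so as not to get the product topology of `ℚ`). -/
def RatPlane : Type := Fin 2 → ℚ

instance : AddCommGroup RatPlane := inferInstanceAs (AddCommGroup (Fin 2 → ℚ))

instance : TopologicalSpace RatPlane := ⊥

instance : DiscreteTopology RatPlane := ⟨rfl⟩

/-- Left multiplication by `g ∈ SL₂(ℚ)` on `ℚ²`. -/
def RatPlane.act (g : SL(2, ℚ)) (v : RatPlane) : RatPlane :=
  Matrix.mulVec (g : Matrix (Fin 2) (Fin 2) ℚ) v

namespace RatPlane

theorem act_zero (g : SL(2, ℚ)) : act g 0 = 0 := Matrix.mulVec_zero _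

theorem act_add (g : SL(2, ℚ)) (v w : RatPlane) : act g (v + w) = act g v + act g w :=
  Matrix.mulVec_add _ _ _

theorem act_neg (g : SL(2, ℚ)) (v : RatPlane) : act g (-v) = -act g v := Matrix.mulVec_neg _ _

theorem act_one (v : RatPlane) : act 1 v = v := Matrix.one_mulVec _

theorem act_mul (g h : SL(2, ℚ)) (v : RatPlane) : act (g * h) v = act g (act h v) :=
  (Matrix.mulVec_mulVec _ _ _).symm

theorem act_of_mem_center {g : SL(2, ℚ)} (hg : g ∈ Subgroup.center SL(2, ℚ)) :
    (∀ v, act g v = v) ∨ ∀ v, act g v = -v := by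
  rw [Matrix.SpecialLinearGroup.mem_center_iff] at hg
  obtain ⟨r, hr, hg⟩ := hg
  have hact : ∀ (v : RatPlane) (i : Fin 2), act g v i = r * v i := fun v i => by
    
    rw [act, ← hg, Matrix.scalar_apply]
    exact Matrix.mulVec_diagonal (fun _ => r) v i
  rw [Fintype.card_fin] at hr
  rcases sq_eq_one_iff.mp hr with rfl | rfl
  · exact Or.inl fun v => funext fun i => (hact v i).trans (one_mul _)
  · exact Or.inr fun v => funext fun i => (hact v i).trans (neg_one_mul _)

end RatPlane

/-- Left multiplication by `g` as a (continuous) endomorphism of `ℚ²`, written multiplicatively. -/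
def RatPlane.actHom (g : SL(2, ℚ)) : Multiplicative RatPlane →ₜ* Multiplicative RatPlane where
  toFun v := Multiplicative.ofAdd (RatPlane.act g v.toAdd)
  map_one' := congrArg Multiplicative.ofAdd (RatPlane.act_zero g)
  map_mul' v w := congrArg Multiplicative.ofAdd (RatPlane.act_add g v.toAdd w.toAdd)
  continuous_toFun := continuous_of_discreteTopology

/-- The compact group `X`, the Pontryagin dual of the discrete group `ℚ²`. -/
abbrev DualRatPlane : Type := PontryaginDual (Multiplicative RatPlane)

namespace DualRatPlane

/-- The value `⟨χ, v⟩` of the character `χ` at `v ∈ ℚ²`. -/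
def pairing (χ : DualRatPlane) (v : RatPlane) : Circle := χ (Multiplicative.ofAdd v)

instance : MeasurableSpace DualRatPlane := borel DualRatPlane

instance : BorelSpace DualRatPlane := ⟨rfl⟩

/-- The normalized Haar measure of `X`. -/
def haar : Measure DualRatPlane := Measure.haarMeasure ⊤

/-- The algebraic action of `SL₂(ℚ)` on `X`: `⟨g χ, v⟩ = ⟨χ, g⁻¹ v⟩`. -/
instance : MulAction SL(2, ℚ) DualRatPlane where
  smul g χ := PontryaginDual.map (RatPlane.actHom g⁻¹) χ
  one_smul χ := PontryaginDual.ext fun v => by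
    change χ (Multiplicative.ofAdd (RatPlane.act 1⁻¹ v.toAdd)) = χ v
    rw [inv_one, RatPlane.act_one]
    rfl
  mul_smul g h χ := PontryaginDual.ext fun v => by
    change χ (Multiplicative.ofAdd (RatPlane.act (g * h)⁻¹ v.toAdd)) =
      χ (Multiplicative.ofAdd (RatPlane.act h⁻¹ (RatPlane.act g⁻¹ v.toAdd)))
    rw [mul_inv_rev, RatPlane.act_mul]

theorem pairing_smul (g : SL(2, ℚ)) (χ : DualRatPlane) (v : RatPlane) :
    (g • χ).pairing v = χ.pairing (RatPlane.act g⁻¹ v) := rfl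

theorem pairing_ext {χ ψ : DualRatPlane} (h : ∀ v, χ.pairing v = ψ.pairing v) : χ = ψ :=
  PontryaginDual.ext fun v => h v.toAdd

/-- The relation on `X` that identifies `φ` with `φ'`, where `φ' v = φ (-v)`. -/
def flipSetoid : Setoid DualRatPlane where
  r φ ψ := ψ = φ ∨ ∀ v, ψ.pairing v = φ.pairing (-v)
  iseqv :=
    { refl := fun _ => Or.inl rfl
      symm := by
        rintro φ ψ (h | h)
        · exact Or.inl h.symm
        · exact Or.inr fun v => by rw [h, neg_neg]
      trans := by
        rintro φ ψ χ (rfl | h) (rfl | h')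
        · exact Or.inl rfl
        · exact Or.inr h'
        · exact Or.inr h
        · exact Or.inl (pairing_ext fun v => by rw [h', h, neg_neg]) }

end DualRatPlane

/-- The quotient space `Y = X / (φ ∼ φ')`. -/
def FlipQuotient : Type := Quotient DualRatPlane.flipSetoid

namespace FlipQuotient

open DualRatPlane

/-- The quotient map `X → Y`. -/
def mk (χ : DualRatPlane) : FlipQuotient := Quotient.mk flipSetoid χ

/-- `Y` carries the quotient Borel structure: `A ⊆ Y` is measurable iff its preimage in `X` is. -/
instance : MeasurableSpace FlipQuotient := MeasurableSpace.map mk inferInstance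

/-- The probability measure on `Y`: the image of the Haar measure of `X`. -/
def measure : Measure FlipQuotient := DualRatPlane.haar.map mk

/-- The quotient action of `SL₂(ℚ)` on `Y`: `g • mk χ = mk (g • χ)`. -/
instance : MulAction SL(2, ℚ) FlipQuotient where
  smul g := Quotient.map (fun χ => g • χ) (by
    rintro φ ψ (rfl | h)
    · exact Or.inl rfl
    · exact Or.inr fun v => by rw [pairing_smul, pairing_smul, h, RatPlane.act_neg])
  one_smul := by
    rintro ⟨χ⟩
    exact congrArg mk (one_smul _ χ)
  mul_smul g h := by
    rintro ⟨χ⟩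
    exact congrArg mk (mul_smul g h χ)

theorem center_le_ker :
    Subgroup.center SL(2, ℚ) ≤ (MulAction.toPermHom SL(2, ℚ) FlipQuotient).ker := by
  intro g hg
  rw [MonoidHom.mem_ker]
  ext y
  obtain ⟨χ⟩ := y
  refine Quotient.sound (s := flipSetoid) ?_
  rcases RatPlane.act_of_mem_center (inv_mem hg) with h | h
  · exact Or.inl (pairing_ext fun v => by rw [pairing_smul, h])
  · exact Or.inr fun v => by rw [pairing_smul, h, neg_neg]

/-- The action of `PSL₂(ℚ) = SL₂(ℚ) / {±1}` on `Y` induced by that of `SL₂(ℚ)`. -/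
instance : MulAction PSL(2, ℚ) FlipQuotient :=
  MulAction.compHom FlipQuotient
    (QuotientGroup.lift (Subgroup.center SL(2, ℚ)) (MulAction.toPermHom SL(2, ℚ) FlipQuotient)
      center_le_ker)

theorem psl_smul_mk (g : SL(2, ℚ)) (χ : DualRatPlane) :
    (QuotientGroup.mk g : PSL(2, ℚ)) • mk χ = mk (g • χ) := rfl

end FlipQuotient

end

/-! Everything is read off the Fourier basis of `L²(X)`: the characters of `X` are the evaluations
at `v ∈ ℚ²`, and `SL₂(ℚ)` permutes them as it permutes `ℚ²`. Square-summability enters through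
`eq_zero_of_coeff_const`: a Fourier coefficient repeated at infinitely many points is zero.

Freeness: for noncentral `g`, both `gχ = χ` and `gχ = χ⁻¹` force `χ(w) = 1` for some fixed `w ≠ 0`,
a null condition. Weak mixing: `diag(2ⁿ, 2⁻ⁿ)` eventually moves each nonzero `v` off any given
vector, so the Koopman operators converge weakly to the projection onto constants.

Primeness: let `E` be the conditional expectation onto the σ-algebra pulled back from `Z`.
Transvections fixing `v` move every `w` not parallel to `v` through infinitely many points, so
`E(char v)` is supported on `ℚv`; by transitivity its coefficient at `x • v` is a number `s(x)`
independent of `v ≠ 0`. The identity `E(E(f) g) = E(f) E(g)` on characters becomes `s(x) s(y) = s(y)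
s(x / y)` (`scalarCoeff_mul`). If `s(y) ≠ 0` with `y ≠ ±1`, then `s` is constant and nonzero on
infinitely many powers, which is impossible. Since the map is even, `E(char v) = s(1) (char v + char
(-v))` (`condChar_ae_eq`). If `s(1) = 0`, then `E` keeps only constants and `Z` is a point;
otherwise every `Re (char v)` factors through `Z`, and these functions separate the points of `Y`.
-/

noncomputable section

open Complex ComplexConjugate Topology Filter

/-! ### Fourier analysis on the dual of `ℚ²` -/

namespace DualRatPlane

instance : Countable RatPlane := inferInstanceAs (Countable (Fin 2 → ℚ))

instance : Module ℚ RatPlane := inferInstanceAs (Module ℚ (Fin 2 → ℚ))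

instance : SecondCountableTopology DualRatPlane :=
  have : Countable (Multiplicative RatPlane) := inferInstanceAs (Countable RatPlane)
  (ContinuousMonoidHom.isInducing_toContinuousMap (Multiplicative RatPlane) Circle).secondCountableTopology

instance : PolishSpace DualRatPlane :=
  letI := TopologicalSpace.metrizableSpaceMetric DualRatPlane
  inferInstance

instance : haar.IsHaarMeasure := inferInstanceAs (Measure.haarMeasure ⊤).IsHaarMeasure

instance : IsProbabilityMeasure haar :=
  ⟨Measure.haarMeasure_self (K₀ := (⊤ : TopologicalSpace.PositiveCompacts DualRatPlane))⟩

theorem measurePreserving_smul (g : SL(2, ℚ)) :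
    MeasurePreserving (fun χ : DualRatPlane => g • χ) haar haar :=
  MonoidHom.measurePreserving (f := (PontryaginDual.map (RatPlane.actHom g⁻¹)).toMonoidHom)
    (PontryaginDual.map (RatPlane.actHom g⁻¹)).continuous_toFun (MulAction.surjective g) rfl

theorem measurePreserving_inv : MeasurePreserving (fun χ : DualRatPlane => χ⁻¹) haar haar :=
  MonoidHom.measurePreserving (f := (invMonoidHom : DualRatPlane →* DualRatPlane))
    continuous_inv inv_surjective rfl

theorem continuous_pairing (v : RatPlane) : Continuous fun χ : DualRatPlane => χ.pairing v :=
  (ContinuousEvalConst.continuous_eval_const (F := C(Multiplicative RatPlane, Circle))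
    (Multiplicative.ofAdd v)).comp
    (ContinuousMonoidHom.isInducing_toContinuousMap (Multiplicative RatPlane) Circle).continuous

theorem pairing_add (χ : DualRatPlane) (v w : RatPlane) :
    χ.pairing (v + w) = χ.pairing v * χ.pairing w := map_mul χ _ _

theorem pairing_zero (χ : DualRatPlane) : χ.pairing 0 = 1 := map_one χ

theorem pairing_neg (χ : DualRatPlane) (v : RatPlane) : χ.pairing (-v) = (χ.pairing v)⁻¹ :=
  map_inv χ (Multiplicative.ofAdd v)

theorem pairing_mul_left (χ ψ : DualRatPlane) (v : RatPlane) :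
    (χ * ψ).pairing v = χ.pairing v * ψ.pairing v := rfl

theorem pairing_inv_left (χ : DualRatPlane) (v : RatPlane) :
    (χ⁻¹).pairing v = (χ.pairing v)⁻¹ := rfl

theorem exists_pairing_eq_neg_one {v : RatPlane} (hv : v ≠ 0) :
    ∃ χ : DualRatPlane, (χ.pairing v : ℂ) = -1 := by
  obtain ⟨i, hi⟩ := Function.ne_iff.1 hv
  -- The character is `w ↦ exp(iπ wᵢ / vᵢ)`, for a coordinate with `vᵢ ≠ 0`.
  refine ⟨⟨⟨⟨fun w => Circle.exp (Real.pi * ((w.toAdd i / v i : ℚ) : ℝ)), ?_⟩, ?_⟩,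
    continuous_of_discreteTopology⟩, ?_⟩
  · change Circle.exp (Real.pi * (((0 : ℚ) / v i : ℚ) : ℝ)) = 1
    simp
  · intro a b
    change Circle.exp (Real.pi * (((a.toAdd i + b.toAdd i : ℚ) / v i : ℚ) : ℝ)) =
      Circle.exp _ * Circle.exp _
    rw [← Circle.exp_add, add_div, Rat.cast_add, mul_add]
  · change (Circle.exp (Real.pi * ((v i / v i : ℚ) : ℝ)) : ℂ) = -1
    have : v i ≠ 0 := hi
    rw [div_self this]
    simp [Circle.coe_exp]

/-- The character of `X` given by evaluation at `v`, as a continuous function. -/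
def char (v : RatPlane) : C(DualRatPlane, ℂ) :=
  ⟨fun χ => (χ.pairing v : ℂ), continuous_subtype_val.comp (continuous_pairing v)⟩

theorem char_apply (v : RatPlane) (χ : DualRatPlane) : char v χ = (χ.pairing v : ℂ) := rfl

theorem char_zero : char 0 = 1 := by
  ext χ; simp [char_apply, pairing_zero]

theorem char_add (v w : RatPlane) : char (v + w) = char v * char w := by
  ext χ; simp [char_apply, pairing_add]

theorem char_neg (v : RatPlane) : char (-v) = star (char v) := by
  ext χ
  rw [char_apply, pairing_neg, Circle.coe_inv_eq_conj]; rfl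

theorem conj_char (v : RatPlane) (χ : DualRatPlane) : conj (char v χ) = char (-v) χ := by
  rw [char_neg]; rfl

theorem norm_char (v : RatPlane) (χ : DualRatPlane) : ‖char v χ‖ = 1 := Circle.norm_coe _

theorem char_smul (g : SL(2, ℚ)) (v : RatPlane) (χ : DualRatPlane) :
    char (RatPlane.act g v) (g • χ) = char v χ := by
  rw [char_apply, pairing_smul, ← RatPlane.act_mul, inv_mul_cancel, RatPlane.act_one]; rfl

theorem char_inv (v : RatPlane) (χ : DualRatPlane) : char v χ⁻¹ = char (-v) χ := by
  rw [char_apply, pairing_inv_left, char_apply, pairing_neg]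

/-- Translating by a `ψ` with `ψ(v) = -1` changes the sign of the integrand but not the integral. -/
theorem integral_char {v : RatPlane} (hv : v ≠ 0) : ∫ χ, char v χ ∂haar = 0 := by
  obtain ⟨ψ, hψ⟩ := exists_pairing_eq_neg_one hv
  refine integral_eq_zero_of_mul_left_eq_neg (g := ψ) fun χ => ?_
  rw [char_apply, pairing_mul_left, Circle.coe_mul, hψ, neg_one_mul]; rfl

/-- The star subalgebra of `C(X, ℂ)` spanned by the characters. -/
def charSubalgebra : StarSubalgebra ℂ C(DualRatPlane, ℂ) where
  toSubalgebra := Algebra.adjoin ℂ (Set.range char)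
  star_mem' := by
    change Algebra.adjoin ℂ (Set.range char) ≤ star (Algebra.adjoin ℂ (Set.range char))
    refine Algebra.adjoin_le ?_
    rintro - ⟨v, rfl⟩
    exact Algebra.subset_adjoin ⟨-v, char_neg v⟩

theorem charSubalgebra_coe :
    Subalgebra.toSubmodule charSubalgebra.toSubalgebra = Submodule.span ℂ (Set.range char) := by
  apply Algebra.adjoin_eq_span_of_subset
  refine Set.Subset.trans ?_ Submodule.subset_span
  intro x hx
  refine Submonoid.closure_induction (fun _ => id) ⟨0, char_zero⟩ ?_ hx
  rintro - - - - ⟨v, rfl⟩ ⟨w, rfl⟩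
  exact ⟨v + w, char_add v w⟩

theorem charSubalgebra_separatesPoints : charSubalgebra.SeparatesPoints := by
  intro χ ψ h
  contrapose! h
  refine pairing_ext fun v => Circle.coe_injective ?_
  exact h _ ⟨char v, Algebra.subset_adjoin ⟨v, rfl⟩, rfl⟩

theorem span_char_closure_eq_top :
    (Submodule.span ℂ (Set.range char)).topologicalClosure = ⊤ := by
  rw [← charSubalgebra_coe]
  exact congr_arg (Subalgebra.toSubmodule <| StarSubalgebra.toSubalgebra ·)
    (ContinuousMap.starSubalgebra_topologicalClosure_eq_top_of_separatesPoints charSubalgebra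
      charSubalgebra_separatesPoints)

/-- The characters as elements of `L²(X)`. -/
abbrev charLp (v : RatPlane) : Lp ℂ 2 haar := ContinuousMap.toLp (E := ℂ) 2 haar ℂ (char v)

theorem span_charLp_closure_eq_top :
    (Submodule.span ℂ (Set.range charLp)).topologicalClosure = ⊤ := by
  convert! (ContinuousMap.toLp_denseRange ℂ haar ℂ
    (ENNReal.ofNat_ne_top (n := 2))).topologicalClosure_map_submodule span_char_closure_eq_top
  rw [Submodule.map_span]
  unfold charLp
  rw [Set.range_comp']
  simp only [ContinuousLinearMap.coe_coe]

theorem orthonormal_charLp : Orthonormal ℂ charLp := by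
  classical
  rw [orthonormal_iff_ite]
  intro v w
  rw [ContinuousMap.inner_toLp haar (char v) (char w)]
  have h : ∀ χ, char w χ * conj (char v χ) = char (w - v) χ := fun χ => by
    rw [conj_char, sub_eq_add_neg, char_add]; rfl
  simp_rw [h]
  split_ifs with hvw
  · simp [hvw, char_zero]
  · exact integral_char (sub_ne_zero.2 (Ne.symm hvw))

/-- The Fourier basis of `L²(X)`. -/
def charBasis : HilbertBasis RatPlane ℂ (Lp ℂ 2 haar) :=
  HilbertBasis.mk orthonormal_charLp span_charLp_closure_eq_top.ge

theorem charBasis_apply (v : RatPlane) : charBasis v = charLp v :=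
  congrFun (HilbertBasis.coe_mk _ _) v

/-- The Fourier coefficient of `f : X → ℂ` at `v`. -/
def coeff (f : DualRatPlane → ℂ) (v : RatPlane) : ℂ := ∫ χ, conj (char v χ) * f χ ∂haar

theorem memLp_char (v : RatPlane) (p : ENNReal) : MemLp (char v) p haar :=
  MemLp.of_bound (char v).continuous.aestronglyMeasurable 1 (ae_of_all _ fun χ => (norm_char v χ).le)

theorem inner_toLp {f g : DualRatPlane → ℂ} (hf : MemLp f 2 haar) (hg : MemLp g 2 haar) :
    inner ℂ (hf.toLp f) (hg.toLp g) = ∫ χ, conj (f χ) * g χ ∂haar := by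
  rw [L2.inner_def]
  refine integral_congr_ae ?_
  filter_upwards [hf.coeFn_toLp, hg.coeFn_toLp] with χ h1 h2
  rw [h1, h2, RCLike.inner_apply, mul_comm]

theorem charLp_eq (v : RatPlane) : charLp v = (memLp_char v 2).toLp (char v) := by
  refine Lp.ext ?_
  filter_upwards [ContinuousMap.coeFn_toLp (p := 2) (𝕜 := ℂ) haar (char v),
    (memLp_char v 2).coeFn_toLp] with χ h1 h2
  rw [h1, h2]

theorem inner_charBasis {f : DualRatPlane → ℂ} (hf : MemLp f 2 haar) (v : RatPlane) :
    inner ℂ (charBasis v) (hf.toLp f) = coeff f v := by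
  rw [charBasis_apply, charLp_eq, inner_toLp]; rfl

theorem hasSum_coeff {f g : DualRatPlane → ℂ} (hf : MemLp f 2 haar) (hg : MemLp g 2 haar) :
    HasSum (fun v => conj (coeff f v) * coeff g v) (∫ χ, conj (f χ) * g χ ∂haar) := by
  rw [← inner_toLp hf hg]
  have h : ∀ v, conj (coeff f v) * coeff g v =
      inner ℂ (hf.toLp f) (charBasis v) * inner ℂ (charBasis v) (hg.toLp g) := fun v => by
    rw [inner_charBasis hg, ← inner_conj_symm, inner_charBasis hf]
  simp_rw [h]
  exact charBasis.hasSum_inner_mul_inner (hf.toLp f) (hg.toLp g)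

theorem coeff_congr_ae {f g : DualRatPlane → ℂ} (h : f =ᵐ[haar] g) : coeff f = coeff g := by
  ext v
  refine integral_congr_ae ?_
  filter_upwards [h] with χ hχ
  rw [hχ]

theorem ae_eq_of_coeff_eq {f g : DualRatPlane → ℂ} (hf : MemLp f 2 haar) (hg : MemLp g 2 haar)
    (h : ∀ v, coeff f v = coeff g v) : f =ᵐ[haar] g := by
  rw [← MemLp.toLp_eq_toLp_iff hf hg]
  refine charBasis.repr.injective (lp.ext (funext fun v => ?_))
  rw [charBasis.repr_apply_apply, charBasis.repr_apply_apply, inner_charBasis, inner_charBasis, h]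

theorem coeff_char (v w : RatPlane) [Decidable (w = v)] :
    coeff (char v) w = if w = v then 1 else 0 := by
  classical
  rw [← inner_charBasis (memLp_char v 2), ← charLp_eq, ← charBasis_apply,
    orthonormal_iff_ite.1 charBasis.orthonormal]
  congr

/-- By Parseval the squared coefficients are summable, so they tend to zero along any injective
sequence. -/
theorem eq_zero_of_coeff_const {f : DualRatPlane → ℂ} (hf : MemLp f 2 haar) {a : ℕ → RatPlane}
    (ha : Function.Injective a) {k : ℂ} (h : ∀ n, coeff f (a n) = k) : k = 0 := by
  have h1 := ((hasSum_coeff hf hf).summable.comp_injective ha).tendsto_atTop_zero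
  simp only [Function.comp_def, h] at h1
  simpa using tendsto_nhds_unique tendsto_const_nhds h1

end DualRatPlane

/-! ### Essential freeness -/

namespace RatPlane

theorem act_injective {g h : SL(2, ℚ)} (H : ∀ v, act g v = act h v) : g = h :=
  Subtype.ext (Matrix.mulVec_injective (funext H))

theorem mem_center_of_act_eq {g : SL(2, ℚ)} (hg : ∀ v, act g v = v) :
    g ∈ Subgroup.center SL(2, ℚ) := by
  rw [act_injective (g := g) (h := 1) fun v => by rw [hg, act_one]]
  exact one_mem _

theorem mem_center_of_act_eq_neg {g : SL(2, ℚ)} (hg : ∀ v, act g v = -v) :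
    g ∈ Subgroup.center SL(2, ℚ) :=
  Subgroup.mem_center_iff.2 fun h => act_injective fun v => by
    rw [act_mul, act_mul, hg, hg, act_neg]

end RatPlane

namespace DualRatPlane

theorem pairing_nat_smul (χ : DualRatPlane) (n : ℕ) (w : RatPlane) :
    χ.pairing ((n : ℚ) • w) = χ.pairing w ^ n := by
  rw [Nat.cast_smul_eq_nsmul]
  exact map_pow χ (Multiplicative.ofAdd w) n

/-- The indicator of this set has the same Fourier coefficient, namely the measure of the set, at
every multiple `n • w`, because `χ(n • w) = 1` there. -/
theorem haar_pairing_eq_one {w : RatPlane} (hw : w ≠ 0) : haar {χ | χ.pairing w = 1} = 0 := by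
  have hm : MeasurableSet {χ : DualRatPlane | χ.pairing w = 1} :=
    (isClosed_eq (continuous_pairing w) continuous_const).measurableSet
  have h := eq_zero_of_coeff_const (f := Set.indicator {χ | χ.pairing w = 1} fun _ => (1 : ℂ))
    (memLp_indicator_const 2 hm 1 (Or.inr (measure_ne_top _ _)))
    (a := fun n : ℕ => (n : ℚ) • w)
    (fun m n hmn => by simpa using smul_left_injective ℚ hw hmn)
    (k := haar.real {χ | χ.pairing w = 1}) fun n => by
      rw [coeff, ← integral_indicator_one hm, ← integral_complex_ofReal]
      congr with χ
      by_cases hχ : χ.pairing w = 1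
      · simp [Set.indicator, hχ, char_apply, pairing_nat_smul]
      · simp [Set.indicator, hχ]
  simpa [measureReal_eq_zero_iff] using h

theorem continuous_smul_left (g : SL(2, ℚ)) : Continuous fun χ : DualRatPlane => g • χ :=
  (PontryaginDual.map (RatPlane.actHom g⁻¹)).continuous_toFun

theorem haar_smul_eq_self {g : SL(2, ℚ)} (hg : g ∉ Subgroup.center SL(2, ℚ)) :
    haar {χ | g • χ = χ} = 0 := by
  obtain ⟨v, hv⟩ := not_forall.1 (mt RatPlane.mem_center_of_act_eq (mt inv_mem_iff.1 hg))
  refine measure_mono_null (fun χ hχ => ?_) (haar_pairing_eq_one (sub_ne_zero.2 hv))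
  have h := congrArg (fun ψ => pairing ψ v) (show g • χ = χ from hχ)
  rw [pairing_smul] at h
  change χ.pairing _ = 1
  rw [sub_eq_add_neg, pairing_add, pairing_neg, h, mul_inv_cancel]

theorem haar_smul_eq_inv {g : SL(2, ℚ)} (hg : g ∉ Subgroup.center SL(2, ℚ)) :
    haar {χ | g • χ = χ⁻¹} = 0 := by
  obtain ⟨v, hv⟩ := not_forall.1 (mt RatPlane.mem_center_of_act_eq_neg (mt inv_mem_iff.1 hg))
  refine measure_mono_null (fun χ hχ => ?_)
    (haar_pairing_eq_one (w := RatPlane.act g⁻¹ v + v) (mt eq_neg_of_add_eq_zero_left hv))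
  have h := congrArg (fun ψ => pairing ψ v) (show g • χ = χ⁻¹ from hχ)
  rw [pairing_smul, pairing_inv_left] at h
  change χ.pairing _ = 1
  rw [pairing_add, h, inv_mul_cancel]

end DualRatPlane

namespace FlipQuotient

open DualRatPlane

theorem measurableSet_iff {s : Set FlipQuotient} : MeasurableSet s ↔ MeasurableSet (mk ⁻¹' s) :=
  Iff.rfl

theorem measurable_mk : Measurable mk := fun _ h => h

theorem measurePreserving_mk : MeasurePreserving mk haar measure := ⟨measurable_mk, rfl⟩

instance : IsProbabilityMeasure measure := Measure.isProbabilityMeasure_map measurable_mk.aemeasurable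

theorem mk_surjective : Function.Surjective mk := Quotient.mk_surjective

theorem mk_eq_mk {χ ψ : DualRatPlane} : mk χ = mk ψ ↔ ψ = χ ∨ ψ = χ⁻¹ := by
  refine (Quotient.eq (r := flipSetoid)).trans (or_congr_right ⟨fun h => pairing_ext fun v => ?_, ?_⟩)
  · rw [h, pairing_neg, pairing_inv_left]
  · rintro rfl v
    rw [pairing_neg, pairing_inv_left]

theorem measurePreserving_smul (g : PSL(2, ℚ)) :
    MeasurePreserving (fun y : FlipQuotient => g • y) measure measure := by
  obtain ⟨g, rfl⟩ := QuotientGroup.mk_surjective g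
  have h := measurePreserving_mk.comp (DualRatPlane.measurePreserving_smul g)
  have hm : Measurable fun y : FlipQuotient => (QuotientGroup.mk g : PSL(2, ℚ)) • y :=
    fun s hs => h.measurable hs
  exact ⟨hm, (Measure.map_map hm measurable_mk).trans h.map_eq⟩

theorem isPMPAction : IsPMPAction PSL(2, ℚ) measure := ⟨inferInstance, measurePreserving_smul⟩

theorem isFreeAction : IsFreeAction PSL(2, ℚ) measure := by
  intro g hg
  obtain ⟨g, rfl⟩ := QuotientGroup.mk_surjective g
  rw [Ne, QuotientGroup.eq_one_iff] at hg
  have h : mk ⁻¹' {y | ¬ (QuotientGroup.mk g : PSL(2, ℚ)) • y ≠ y} =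
      {χ | g • χ = χ} ∪ {χ | g • χ = χ⁻¹} := by
    ext χ
    change ¬ mk (g • χ) ≠ mk χ ↔ _
    rw [not_not, eq_comm, mk_eq_mk]
    rfl
  have hm : MeasurableSet {y : FlipQuotient | ¬ (QuotientGroup.mk g : PSL(2, ℚ)) • y ≠ y} := by
    rw [measurableSet_iff, h]
    exact (isClosed_eq (continuous_smul_left g) continuous_id).measurableSet.union
      (isClosed_eq (continuous_smul_left g) continuous_inv).measurableSet
  rw [ae_iff, ← measurePreserving_mk.measure_preimage hm.nullMeasurableSet, h]
  exact measure_union_null (haar_smul_eq_self hg) (haar_smul_eq_inv hg)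

end FlipQuotient

/-! ### Weak mixing -/

section Hilbert

variable {ι H : Type*} [NormedAddCommGroup H] [InnerProductSpace ℂ H]

/-- Uniformly bounded linear functionals that tend to zero on a set with dense span tend to zero
everywhere. -/
theorem HilbertBasis.tendsto_apply_zero (b : HilbertBasis ι ℂ H) {φ : ℕ → H → ℂ} {C : ℝ}
    (hadd : ∀ n x y, φ n (x + y) = φ n x + φ n y) (hsmul : ∀ n (c : ℂ) x, φ n (c • x) = c * φ n x)
    (hC : ∀ n x, ‖φ n x‖ ≤ C * ‖x‖) (hb : ∀ i, Tendsto (fun n => φ n (b i)) atTop (𝓝 0)) (x : H) :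
    Tendsto (fun n => φ n x) atTop (𝓝 0) := by
  have hspan : ∀ x ∈ Submodule.span ℂ (Set.range b), Tendsto (fun n => φ n x) atTop (𝓝 0) := by
    intro x hx
    induction hx using Submodule.span_induction with
    | mem x h => obtain ⟨i, rfl⟩ := h; exact hb i
    | zero =>
      have : ∀ n, φ n 0 = 0 := fun n => by simpa using hsmul n 0 0
      simp [this]
    | add x y _ _ hx hy => simpa [hadd] using hx.add hy
    | smul c x _ hx => simpa [hsmul] using hx.const_mul c
  have hx : x ∈ (Submodule.span ℂ (Set.range b)).topologicalClosure := by
    rw [b.dense_span]; trivial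
  rw [Metric.tendsto_atTop]
  intro ε hε
  have hC' : 0 < |C| + 1 := by positivity
  obtain ⟨y, hy, hxy⟩ := Metric.mem_closure_iff.1 hx (ε / 2 / (|C| + 1)) (by positivity)
  obtain ⟨N, hN⟩ := Metric.tendsto_atTop.1 (hspan y hy) (ε / 2) (half_pos hε)
  refine ⟨N, fun n hn => ?_⟩
  have h1 := hN n hn
  rw [dist_zero_right] at h1 ⊢
  have h2 : φ n x = φ n (x - y) + φ n y := by rw [← hadd, sub_add_cancel]
  have h3 : ‖φ n (x - y)‖ ≤ ε / 2 := by
    rw [dist_eq_norm, lt_div_iff₀ hC'] at hxy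
    calc ‖φ n (x - y)‖ ≤ C * ‖x - y‖ := hC n _
      _ ≤ (|C| + 1) * ‖x - y‖ := by gcongr; linarith [le_abs_self C]
      _ ≤ ε / 2 := by rw [mul_comm]; exact hxy.le
  rw [h2]
  linarith [norm_add_le (φ n (x - y)) (φ n y)]

theorem HilbertBasis.tendsto_inner_zero (b : HilbertBasis ι ℂ H) {T : ℕ → H →L[ℂ] H} {C : ℝ}
    (hC : ∀ n, ‖T n‖ ≤ C) (hb : ∀ i j, Tendsto (fun n => inner ℂ (b i) (T n (b j))) atTop (𝓝 0))
    (x y : H) : Tendsto (fun n => inner ℂ x (T n y)) atTop (𝓝 0) := by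
  have hT : ∀ n x, ‖T n x‖ ≤ C * ‖x‖ := fun n x => (T n).le_of_opNorm_le (hC n) x
  have h1 : ∀ i y, Tendsto (fun n => inner ℂ (b i) (T n y)) atTop (𝓝 0) := fun i y =>
    b.tendsto_apply_zero (φ := fun n y => inner ℂ (b i) (T n y)) (C := C)
      (fun n x y => by rw [map_add, inner_add_right])
      (fun n c x => by rw [map_smul, inner_smul_right])
      (fun n x => (norm_inner_le_norm _ _).trans (by
        rw [b.orthonormal.1 i, one_mul]; exact hT n x)) (hb i) y
  have h2 := b.tendsto_apply_zero (φ := fun n x => inner ℂ (T n y) x) (C := C * ‖y‖)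
    (fun n x y => inner_add_right _ _ _) (fun n c x => inner_smul_right _ _ _)
    (fun n x => (norm_inner_le_norm _ _).trans (by gcongr; exact hT n y))
    (fun i => by
      have := (Complex.continuous_conj.tendsto _).comp (h1 i y)
      simpa [Function.comp_def] using this) x
  have := (Complex.continuous_conj.tendsto _).comp h2
  simpa [Function.comp_def] using this

end Hilbert

/-- The diagonal matrix `diag(2ⁿ, 2⁻ⁿ)`. -/
def RatPlane.diagPow (n : ℕ) : SL(2, ℚ) :=
  ⟨!![2 ^ n, 0; 0, (2 ^ n)⁻¹], by rw [Matrix.det_fin_two_of]; field_simp; ring⟩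

theorem RatPlane.eventually_act_diagPow_ne {v : RatPlane} (hv : v ≠ 0) (w : RatPlane) :
    ∀ᶠ n in atTop, RatPlane.act (RatPlane.diagPow n) v ≠ w := by
  have h0 : ∀ n, RatPlane.act (RatPlane.diagPow n) v 0 = 2 ^ n * v 0 := fun n => by
    simp [RatPlane.act, RatPlane.diagPow, Matrix.mulVec, dotProduct, Fin.sum_univ_two]
  have h1 : ∀ n, RatPlane.act (RatPlane.diagPow n) v 1 = (2 ^ n)⁻¹ * v 1 := fun n => by
    simp [RatPlane.act, RatPlane.diagPow, Matrix.mulVec, dotProduct, Fin.sum_univ_two]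
  -- An injective sequence of vectors meets any given `w` at most once; a nonzero coordinate of `v`
  -- is scaled by distinct powers of `2` or of `1/2`.
  have hinj : Function.Injective fun n => RatPlane.act (RatPlane.diagPow n) v := by
    intro m n hmn
    have e0 := congrFun hmn 0
    have e1 := congrFun hmn 1
    simp only [h0, h1] at e0 e1
    obtain ⟨i, hi⟩ := Function.ne_iff.1 hv
    have hp : Function.Injective fun n : ℕ => (2 : ℚ) ^ n :=
      pow_right_injective₀ (by norm_num) (by norm_num)
    fin_cases i
    · exact hp (mul_right_cancel₀ hi e0)
    · exact hp (inv_injective (mul_right_cancel₀ hi e1))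
  rw [← Nat.cofinite_eq_atTop]
  exact hinj.tendsto_cofinite.eventually (eventually_cofinite_ne w)

namespace DualRatPlane

/-- The Koopman operator on `L²(X)`: composition with the action of `g⁻¹`. -/
def koopman (g : SL(2, ℚ)) : Lp ℂ 2 haar →ₗᵢ[ℂ] Lp ℂ 2 haar :=
  Lp.compMeasurePreservingₗᵢ ℂ (fun χ => g⁻¹ • χ) (measurePreserving_smul g⁻¹)

theorem koopman_toLp (g : SL(2, ℚ)) {f : DualRatPlane → ℂ} (hf : MemLp f 2 haar) :
    koopman g (hf.toLp f) =
      (hf.comp_measurePreserving (measurePreserving_smul g⁻¹)).toLp _ := rfl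

theorem koopman_charBasis (g : SL(2, ℚ)) (v : RatPlane) :
    koopman g (charBasis v) = charBasis (RatPlane.act g v) := by
  rw [charBasis_apply, charBasis_apply, charLp_eq, charLp_eq, koopman_toLp]
  congr 1
  ext χ
  have := char_smul g v (g⁻¹ • χ)
  rw [smul_inv_smul] at this
  exact this.symm

theorem tendsto_inner_koopman {s : ℕ → SL(2, ℚ)}
    (hs : ∀ v ≠ 0, ∀ w, ∀ᶠ n in atTop, RatPlane.act (s n) v ≠ w) (x y : Lp ℂ 2 haar) :
    Tendsto (fun n => inner ℂ x (koopman (s n) y)) atTop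
      (𝓝 (inner ℂ x (charBasis 0) * inner ℂ (charBasis 0) y)) := by
  classical
  -- `P` is the orthogonal projection onto the constants, the expected weak limit.
  let P : Lp ℂ 2 haar →L[ℂ] Lp ℂ 2 haar :=
    (innerSL ℂ (charBasis 0)).smulRight (charBasis 0)
  have hP : ∀ y, P y = inner ℂ (charBasis 0) y • charBasis 0 := fun y => rfl
  have h := charBasis.tendsto_inner_zero (T := fun n => (koopman (s n)).toContinuousLinearMap - P)
    (C := 1 + ‖P‖) (fun n => (norm_sub_le _ _).trans (by
      gcongr; exact LinearIsometry.norm_toContinuousLinearMap_le _)) (fun v w => ?_) x y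
  · have h' := h.add_const (inner ℂ x (P y))
    simp only [sub_apply, inner_sub_right, sub_add_cancel, zero_add] at h'
    rw [hP, inner_smul_right, mul_comm] at h'
    exact h'
  · refine tendsto_const_nhds.congr' ?_
    have ho := orthonormal_iff_ite.1 charBasis.orthonormal
    by_cases hw : w = 0
    · subst hw
      refine Eventually.of_forall fun n => ?_
      change 0 = inner ℂ (charBasis v) (koopman (s n) (charBasis 0) - P (charBasis 0))
      rw [hP, ho, if_pos rfl, one_smul, koopman_charBasis, RatPlane.act_zero, sub_self, inner_zero_right]
    · filter_upwards [hs w hw v] with n hn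
      change 0 = inner ℂ (charBasis v) (koopman (s n) (charBasis w) - P (charBasis w))
      rw [hP, ho, if_neg (Ne.symm hw), zero_smul, sub_zero, koopman_charBasis, ho, if_neg hn.symm]

theorem tendsto_haar_inter {s : ℕ → SL(2, ℚ)}
    (hs : ∀ v ≠ 0, ∀ w, ∀ᶠ n in atTop, RatPlane.act (s n) v ≠ w) {A B : Set DualRatPlane}
    (hA : MeasurableSet A) (hB : MeasurableSet B) :
    Tendsto (fun n => haar.real ((fun χ => (s n)⁻¹ • χ) ⁻¹' A ∩ B)) atTop
      (𝓝 (haar.real A * haar.real B)) := by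
  have hi : ∀ {C : Set DualRatPlane}, MeasurableSet C →
      MemLp (C.indicator fun _ => (1 : ℂ)) 2 haar := fun hC =>
    memLp_indicator_const 2 hC 1 (Or.inr (measure_ne_top _ _))
  have hint : ∀ {C : Set DualRatPlane}, MeasurableSet C →
      ∫ χ, C.indicator (fun _ => (1 : ℂ)) χ ∂haar = haar.real C := fun hC => by
    rw [integral_indicator_const _ hC]; simp
  have hc : ∀ {C : Set DualRatPlane} (hC : MeasurableSet C),
      inner ℂ (charBasis 0) ((hi hC).toLp _) = (haar.real C : ℂ) := fun hC => by
    rw [inner_charBasis, coeff, ← hint hC]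
    simp [char_zero]
  have h := tendsto_inner_koopman hs ((hi hB).toLp _) ((hi hA).toLp _)
  rw [← inner_conj_symm, hc hB, hc hA, conj_ofReal, ← ofReal_mul, mul_comm] at h
  have h2 : ∀ n, inner ℂ ((hi hB).toLp _) (koopman (s n) ((hi hA).toLp _)) =
      ((haar.real ((fun χ => (s n)⁻¹ • χ) ⁻¹' A ∩ B) : ℝ) : ℂ) := fun n => by
    rw [koopman_toLp, inner_toLp,
      ← hint (((measurePreserving_smul (s n)⁻¹).measurable hA).inter hB)]
    congr with χ
    by_cases h1 : χ ∈ B <;> by_cases h2 : (s n)⁻¹ • χ ∈ A <;> simp [h1, h2, Set.indicator]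
  simp_rw [h2] at h
  exact tendsto_ofReal_iff.1 h

end DualRatPlane

namespace FlipQuotient

open DualRatPlane

theorem isWeaklyMixingAction : IsWeaklyMixingAction PSL(2, ℚ) measure := by
  intro Ω hΩ hm ε hε
  have key : ∀ A ∈ Ω, ∀ B ∈ Ω, ∀ᶠ n in atTop,
      |measure.real (((fun y : FlipQuotient =>
        (QuotientGroup.mk (RatPlane.diagPow n) : PSL(2, ℚ)) • y) '' A) ∩ B) -
          measure.real A * measure.real B| < ε := by
    intro A hA B hB
    have h := tendsto_haar_inter (s := RatPlane.diagPow)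
      (fun v hv w => RatPlane.eventually_act_diagPow_ne hv w)
      (measurable_mk (hm A hA)) (measurable_mk (hm B hB))
    have hr : ∀ C : Set FlipQuotient, MeasurableSet C →
        measure.real C = haar.real (mk ⁻¹' C) := fun C hC =>
      (measurePreserving_mk.measureReal_preimage hC.nullMeasurableSet).symm
    filter_upwards [Metric.tendsto_nhds.1 h ε hε] with n hn
    have hpre : ((fun y : FlipQuotient =>
        (QuotientGroup.mk (RatPlane.diagPow n) : PSL(2, ℚ)) • y) '' A) =
        (fun y => (QuotientGroup.mk (RatPlane.diagPow n) : PSL(2, ℚ))⁻¹ • y) ⁻¹' A :=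
      congrFun (Set.image_eq_preimage_of_inverse (inv_smul_smul _) (smul_inv_smul _)) A
    rw [hpre, hr _ (hm A hA), hr _ (hm B hB),
      hr _ (((FlipQuotient.measurePreserving_smul _).measurable (hm A hA)).inter (hm B hB))]
    exact hn
  have := (hΩ.eventually_all (l := atTop)).2 fun A hA => (hΩ.eventually_all (l := atTop)).2 (key A hA)
  obtain ⟨n, hn⟩ := this.exists
  exact ⟨_, hn⟩

end FlipQuotient

/-! ### Transitivity and transvections on `ℚ²` -/

namespace RatPlane

/-- The vector of `ℚ²` with coordinates `a` and `b`. -/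
def vec (a b : ℚ) : RatPlane := ![a, b]

theorem vec_zero (a b : ℚ) : vec a b 0 = a := rfl

theorem vec_one (a b : ℚ) : vec a b 1 = b := rfl

theorem ext_coord {v w : RatPlane} (h0 : v 0 = w 0) (h1 : v 1 = w 1) : v = w :=
  funext (Fin.forall_fin_two.2 ⟨h0, h1⟩)

theorem add_coord (v w : RatPlane) (i : Fin 2) : (v + w) i = v i + w i := rfl

theorem smul_coord (x : ℚ) (v : RatPlane) (i : Fin 2) : (x • v) i = x * v i := rfl

theorem zero_coord (i : Fin 2) : (0 : RatPlane) i = 0 := rfl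

theorem act_coord (g : SL(2, ℚ)) (v : RatPlane) (i : Fin 2) :
    act g v i = g.1 i 0 * v 0 + g.1 i 1 * v 1 := by
  simp [act, Matrix.mulVec, dotProduct, Fin.sum_univ_two]

theorem act_smul (g : SL(2, ℚ)) (x : ℚ) (v : RatPlane) : act g (x • v) = x • act g v :=
  Matrix.mulVec_smul _ _ _

theorem exists_act_eq {v : RatPlane} (hv : v ≠ 0) : ∃ g : SL(2, ℚ), act g (vec 1 0) = v := by
  by_cases h : v 0 = 0
  · have h1 : v 1 ≠ 0 := fun h1 => hv (ext_coord h h1)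
    refine ⟨⟨!![0, -(v 1)⁻¹; v 1, 0], by rw [Matrix.det_fin_two_of]; field_simp; ring⟩, ?_⟩
    refine ext_coord ((act_coord _ _ 0).trans ?_) ((act_coord _ _ 1).trans ?_) <;> simp [vec_zero, vec_one, h]
  · refine ⟨⟨!![v 0, 0; v 1, (v 0)⁻¹], by rw [Matrix.det_fin_two_of]; field_simp; ring⟩, ?_⟩
    refine ext_coord ((act_coord _ _ 0).trans ?_) ((act_coord _ _ 1).trans ?_) <;> simp [vec_zero, vec_one]

/-- The transvection `w ↦ w + t * det (v, w) • v`, which fixes `v`. -/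
def transvection (v : RatPlane) (t : ℚ) : SL(2, ℚ) :=
  ⟨!![1 - t * v 0 * v 1, t * v 0 ^ 2; -t * v 1 ^ 2, 1 + t * v 0 * v 1], by
    rw [Matrix.det_fin_two_of]; ring⟩

theorem act_transvection (v : RatPlane) (t : ℚ) (w : RatPlane) :
    act (transvection v t) w = w + (t * (v 0 * w 1 - v 1 * w 0)) • v := by
  refine ext_coord ?_ ?_ <;>
    rw [act_coord, add_coord, smul_coord] <;> simp [transvection] <;> ring

end RatPlane

/-! ### Conditional expectations of characters -/

namespace DualRatPlane

open RatPlane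

variable {Z : Type*} [mZ : MeasurableSpace Z]

/-- The conditional expectation of the character at `v` given the map `π`. -/
def condChar (π : DualRatPlane → Z) (v : RatPlane) : DualRatPlane → ℂ :=
  haar[char v | mZ.comap π]

theorem memLp_condChar (π : DualRatPlane → Z) (v : RatPlane) : MemLp (condChar π v) 2 haar :=
  MemLp.condExp one_le_two (memLp_char v 2)

theorem exists_condChar_eq_comp (π : DualRatPlane → Z) (v : RatPlane) :
    ∃ h : Z → ℂ, StronglyMeasurable h ∧ condChar π v = h ∘ π :=
  stronglyMeasurable_condExp.exists_eq_measurable_comp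

theorem _root_.MeasureTheory.integral_conj_condExp_mul {Ω : Type*} {m m₀ : MeasurableSpace Ω}
    {μ : Measure Ω} [IsFiniteMeasure μ] (hm : m ≤ m₀) {f g : Ω → ℂ}
    (hf : MemLp f 2 μ) (hg : MemLp g 2 μ) :
    ∫ x, conj (μ[f | m] x) * g x ∂μ = ∫ x, conj (f x) * μ[g | m] x ∂μ := by
  have h := inner_condExpL2_left_eq_right (𝕜 := ℂ) hm (f := hf.toLp f) (g := hg.toLp g)
  rw [L2.inner_def, L2.inner_def] at h
  refine (integral_congr_ae ?_).trans (h.trans (integral_congr_ae ?_))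
  · filter_upwards [hf.condExpL2_ae_eq_condExp (𝕜 := ℂ) hm, hg.coeFn_toLp] with x h1 h2
    rw [h1, h2, RCLike.inner_apply, mul_comm]
  · filter_upwards [hg.condExpL2_ae_eq_condExp (𝕜 := ℂ) hm, hf.coeFn_toLp] with x h1 h2
    rw [h1, h2, RCLike.inner_apply, mul_comm]

/-- This is self-adjointness of the conditional expectation, in matrix coefficients. -/
theorem coeff_condChar_conj {π : DualRatPlane → Z} (hπ : Measurable π) (v w : RatPlane) :
    conj (coeff (condChar π v) w) = coeff (condChar π w) v := by
  rw [coeff, condChar, ← integral_conj_condExp_mul hπ.comap_le (memLp_char w 2) (memLp_char v 2),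
    ← integral_conj, coeff, condChar]
  congr with χ
  rw [map_mul, conj_conj, mul_comm]

theorem coeff_condChar_zero {π : DualRatPlane → Z} (hπ : Measurable π) {v : RatPlane}
    (hv : v ≠ 0) : coeff (condChar π v) 0 = 0 := by
  rw [coeff, char_zero, ← integral_char hv,
    ← integral_condExp hπ.comap_le (f := char v)]
  simp only [ContinuousMap.one_apply, map_one, one_mul]
  rfl

/-- A function of `π` is even when `π` is, so its Fourier coefficients are even too. -/
theorem coeff_condChar_neg {π : DualRatPlane → Z} (hinv : ∀ χ, π χ⁻¹ = π χ) (v w : RatPlane) :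
    coeff (condChar π v) (-w) = coeff (condChar π v) w := by
  obtain ⟨h, -, hh⟩ := exists_condChar_eq_comp π v
  have he : MeasurableEmbedding fun χ : DualRatPlane => χ⁻¹ :=
    continuous_inv.measurableEmbedding inv_injective
  rw [coeff, coeff, ← measurePreserving_inv.integral_comp he]
  congr with χ
  rw [hh, char_inv, neg_neg, Function.comp_apply, Function.comp_apply, hinv]

theorem measurableEmbedding_smul (g : SL(2, ℚ)) :
    MeasurableEmbedding fun χ : DualRatPlane => g • χ :=
  (continuous_smul_left g).measurableEmbedding (MulAction.injective g)

section Equivariant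

variable {π : DualRatPlane → Z} (hπ : Measurable π)
  (heq : ∀ g : SL(2, ℚ), ∃ φ : Z → Z, Measurable φ ∧ ∀ᵐ χ ∂haar, π (g • χ) = φ (π χ))

include hπ heq

/-- Up to a null set, translation by `g` pulls `π ⁻¹' B` back to `π ⁻¹' (φ ⁻¹' B)`, so the
pulled-back σ-algebra is invariant modulo null sets. Only a measurable `φ` for each `g` is needed;
neither the group law on `Z` nor its invariant measure plays a role. -/
theorem condChar_act (g : SL(2, ℚ)) (v : RatPlane) :
    (fun χ => condChar π v (g⁻¹ • χ)) =ᵐ[haar] condChar π (act g v) := by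
  have hmp := measurePreserving_smul g⁻¹
  refine ae_eq_condExp_of_forall_setIntegral_eq hπ.comap_le
    ((memLp_char _ 2).integrable one_le_two) (fun s _ _ => ?_) (fun s hs _ => ?_) ?_
  · exact (((memLp_condChar π v).comp_measurePreserving hmp).integrable one_le_two).integrableOn
  · obtain ⟨B, hB, rfl⟩ := hs
    obtain ⟨φ, hφ, hφπ⟩ := heq g
    have hpre : π ⁻¹' B = (fun χ => g⁻¹ • χ) ⁻¹' ((fun χ => g • χ) ⁻¹' (π ⁻¹' B)) := by
      ext χ; simp
    have hae : ((fun χ => g • χ) ⁻¹' (π ⁻¹' B) : Set DualRatPlane) =ᵐ[haar] π ⁻¹' (φ ⁻¹' B) := by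
      filter_upwards [hφπ] with χ hχ
      exact congrArg (· ∈ B) hχ
    have hchar : ∀ χ, char (act g v) χ = char v (g⁻¹ • χ) := fun χ => by
      rw [← char_smul g v (g⁻¹ • χ), smul_inv_smul]
    simp_rw [hchar]
    rw [hpre, hmp.setIntegral_preimage_emb (measurableEmbedding_smul _),
      hmp.setIntegral_preimage_emb (measurableEmbedding_smul _),
      setIntegral_congr_set hae, setIntegral_congr_set hae]
    exact setIntegral_condExp hπ.comap_le ((memLp_char _ 2).integrable one_le_two)
      ⟨_, hφ hB, rfl⟩
  · obtain ⟨φ, hφ, hφπ⟩ := heq g⁻¹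
    obtain ⟨h, hh, hhπ⟩ := exists_condChar_eq_comp π v
    refine ⟨(h ∘ φ) ∘ π, (hh.comp_measurable hφ).comp_measurable (comap_measurable π), ?_⟩
    filter_upwards [hφπ] with χ hχ
    rw [hhπ, Function.comp_apply, hχ]; rfl

theorem coeff_condChar_act (g : SL(2, ℚ)) (v w : RatPlane) :
    coeff (condChar π (act g v)) (act g w) = coeff (condChar π v) w := by
  rw [← coeff_congr_ae (condChar_act hπ heq g v), coeff, coeff,
    ← (measurePreserving_smul g).integral_comp (measurableEmbedding_smul g)]
  simp_rw [inv_smul_smul, char_smul]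

/-- The transvections along `v` fix `v`, hence preserve the coefficients of `condChar π v`, yet they
move `w` to infinitely many points. -/
theorem coeff_condChar_eq_zero_of_det_ne_zero {v w : RatPlane}
    (h : v 0 * w 1 - v 1 * w 0 ≠ 0) : coeff (condChar π v) w = 0 := by
  have hv : v ≠ 0 := by
    rintro rfl
    simp [zero_coord] at h
  refine eq_zero_of_coeff_const (memLp_condChar π v)
    (a := fun n : ℕ => act (transvection v n) w) (fun m n hmn => ?_) fun n => ?_
  · simp only [act_transvection, add_right_inj] at hmn
    exact_mod_cast mul_right_cancel₀ h (smul_left_injective ℚ hv hmn)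
  · have hfix : act (transvection v n) v = v := by
      rw [act_transvection, mul_comm (v 1), sub_self, mul_zero, zero_smul, add_zero]
    rw [← coeff_condChar_act hπ heq (transvection v n) v w, hfix]

theorem coeff_condChar_smul {v : RatPlane} (hv : v ≠ 0) (x : ℚ) :
    coeff (condChar π v) (x • v) = coeff (condChar π (vec 1 0)) (x • vec 1 0) := by
  obtain ⟨g, rfl⟩ := exists_act_eq hv
  rw [← act_smul, coeff_condChar_act hπ heq]

end Equivariant

/-- Both sides compute, by Parseval, the pairing of `char z` with `E(char v) E(char w)`. On the left
this product is `E(E(char v) char w)`, and `E` is moved onto `char z`; on the right `E(char v)` is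
moved across the inner product. Each factor paired stays in `L²` because characters are bounded. -/
theorem tsum_coeff_condChar {π : DualRatPlane → Z} (hπ : Measurable π) (v w z : RatPlane) :
    ∑' a, conj (coeff (condChar π z) a) * coeff (condChar π v) (a - w) =
      ∑' a, coeff (condChar π v) (z - a) * coeff (condChar π w) a := by
  have hTv := memLp_condChar π v
  have h1 : MemLp (fun χ => condChar π v χ * char w χ) 2 haar :=
    MemLp.mul' (memLp_char w ⊤) hTv
  have h2 : MemLp (fun χ => char z χ * conj (condChar π v χ)) 2 haar :=
    MemLp.mul' hTv.star (memLp_char z ⊤)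
  have e1 : ∀ a, coeff (condChar π v) (a - w) =
      coeff (fun χ => condChar π v χ * char w χ) a := fun a => by
    rw [coeff, coeff]
    congr with χ
    rw [conj_char, conj_char, neg_sub, sub_eq_add_neg, char_add, ContinuousMap.mul_apply]
    ring
  have e2 : ∀ a, coeff (condChar π v) (z - a) =
      conj (coeff (fun χ => char z χ * conj (condChar π v χ)) a) := fun a => by
    rw [coeff, coeff, ← integral_conj]
    congr with χ
    rw [map_mul, map_mul, conj_conj, conj_conj, conj_char, conj_char, neg_sub, sub_eq_add_neg,
      char_add, ContinuousMap.mul_apply]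
    ring
  simp_rw [e1, e2]
  rw [(hasSum_coeff (memLp_condChar π z) h1).tsum_eq,
    (hasSum_coeff h2 (memLp_condChar π w)).tsum_eq, condChar,
    integral_conj_condExp_mul hπ.comap_le (memLp_char z 2) h1]
  refine integral_congr_ae ?_
  have hpull := condExp_bilin_of_aestronglyMeasurable_left (.mul ℝ ℂ) (μ := haar)
    (m := mZ.comap π) (f := condChar π v) (g := char w)
    stronglyMeasurable_condExp.aestronglyMeasurable (h1.integrable one_le_two)
    ((memLp_char w 2).integrable one_le_two)
  filter_upwards [hpull] with χ hχ
  refine (congrArg (conj (char z χ) * ·) hχ).trans ?_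
  rw [map_mul, conj_conj]
  exact (mul_assoc _ _ _).symm

end DualRatPlane

/-! ### The multiplicative relation and the form of the conditional expectation -/

namespace DualRatPlane

open RatPlane

variable {Z : Type*} [mZ : MeasurableSpace Z]

section Equivariant

variable {π : DualRatPlane → Z} (hπ : Measurable π)
  (heq : ∀ g : SL(2, ℚ), ∃ φ : Z → Z, Measurable φ ∧ ∀ᵐ χ ∂haar, π (g • χ) = φ (π χ))

/-- The Fourier coefficient at `x • v` of the conditional expectation of the character at `v`, for
any `v ≠ 0`. -/
def scalarCoeff (π : DualRatPlane → Z) (x : ℚ) : ℂ :=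
  coeff (condChar π (vec 1 0)) (x • vec 1 0)

include hπ heq

theorem coeff_condChar_smul_eq {v : RatPlane} (hv : v ≠ 0) (x : ℚ) :
    coeff (condChar π v) (x • v) = scalarCoeff π x :=
  coeff_condChar_smul hπ heq hv x

omit heq in
theorem scalarCoeff_zero : scalarCoeff π 0 = 0 := by
  rw [scalarCoeff, zero_smul]
  exact coeff_condChar_zero hπ fun h => one_ne_zero (congrFun h 0)

theorem conj_scalarCoeff_inv {y : ℚ} (hy : y ≠ 0) :
    conj (scalarCoeff π y⁻¹) = scalarCoeff π y := by
  have h0 : y • vec 1 0 ≠ 0 := fun h => hy ((mul_one y).symm.trans (congrFun h 0))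
  rw [← coeff_condChar_smul_eq hπ heq h0, coeff_condChar_conj hπ, smul_smul, inv_mul_cancel₀ hy,
    one_smul]
  rfl

/-- The pull-out identity is applied to `v = e₁`, `w = e₂`, `z = (x, y)`. As coefficients vanish off
parallel vectors, one term survives on each side. -/
theorem scalarCoeff_mul (x : ℚ) {y : ℚ} (hy : y ≠ 0) :
    scalarCoeff π x * scalarCoeff π y = scalarCoeff π y * scalarCoeff π (x / y) := by
  have hv : vec 1 0 ≠ 0 := fun h => one_ne_zero (congrFun h 0)
  have hw : vec 0 1 ≠ 0 := fun h => one_ne_zero (congrFun h 1)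
  have hz : vec x y ≠ 0 := fun h => hy (congrFun h 1)
  have h := tsum_coeff_condChar hπ (vec 1 0) (vec 0 1) (vec x y)
  -- On the left `a ∥ z` and `a - e₂ ∥ e₁` force `a = (x/y, 1)`; on the right `a ∥ e₂` and `z - a ∥
  -- e₁` force `a = (0, y)`.
  rw [tsum_eq_single (vec (x / y) 1), tsum_eq_single (vec 0 y)] at h
  · have e1 : vec (x / y) 1 = y⁻¹ • vec x y := ext_coord
      (show x / y = y⁻¹ * x by rw [div_eq_inv_mul]) (show (1 : ℚ) = y⁻¹ * y from (inv_mul_cancel₀ hy).symm)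
    have e2 : vec (x / y) 1 - vec 0 1 = (x / y) • vec 1 0 := ext_coord
      (show x / y - 0 = x / y * 1 by ring) (show (1 : ℚ) - 1 = x / y * 0 by ring)
    have e3 : vec x y - vec 0 y = x • vec 1 0 := ext_coord
      (show x - 0 = x * 1 by ring) (show y - y = x * 0 by ring)
    have e4 : vec 0 y = y • vec 0 1 := ext_coord
      (show 0 = y * 0 by ring) (show y = y * 1 by ring)
    rw [e2, e1, e3, e4, coeff_condChar_smul_eq hπ heq hz, coeff_condChar_smul_eq hπ heq hv,
      coeff_condChar_smul_eq hπ heq hw, coeff_condChar_smul_eq hπ heq hv,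
      conj_scalarCoeff_inv hπ heq hy] at h
    exact h.symm
  · intro a ha
    by_cases h0 : a 0 = 0
    · rw [coeff_condChar_eq_zero_of_det_ne_zero hπ heq, zero_mul]
      change (1 : ℚ) * (y - a 1) - 0 * (x - a 0) ≠ 0
      rw [one_mul, zero_mul, sub_zero]
      exact sub_ne_zero.2 fun h1 => ha (ext_coord h0 h1.symm)
    · rw [coeff_condChar_eq_zero_of_det_ne_zero hπ heq (v := vec 0 1) (w := a), mul_zero]
      change (0 : ℚ) * a 1 - 1 * a 0 ≠ 0
      simpa using h0
  · intro a ha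
    by_cases h1 : a 1 = 1
    · rw [coeff_condChar_eq_zero_of_det_ne_zero hπ heq (v := vec x y) (w := a), map_zero, zero_mul]
      change x * a 1 - y * a 0 ≠ 0
      rw [h1, mul_one]
      refine sub_ne_zero.2 fun h0 => ha (ext_coord ?_ h1)
      change a 0 = x / y
      rw [h0, mul_div_cancel_left₀ _ hy]
    · rw [coeff_condChar_eq_zero_of_det_ne_zero hπ heq (v := vec 1 0), mul_zero]
      change (1 : ℚ) * (a 1 - 1) - 0 * (a 0 - 0) ≠ 0
      rw [one_mul, zero_mul, sub_zero]
      exact sub_ne_zero.2 h1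

theorem scalarCoeff_eq_zero {y : ℚ} (h1 : y ≠ 1) (h2 : y ≠ -1) : scalarCoeff π y = 0 := by
  by_cases hy : y = 0
  · rw [hy, scalarCoeff_zero hπ]
  by_contra hc
  -- Cancelling `s(y) ≠ 0` makes `s` invariant under division by `y`; in particular `s(1) = s(y) ≠
  -- 0`.
  have hdiv : ∀ x, scalarCoeff π x = scalarCoeff π (x / y) := fun x =>
    mul_left_cancel₀ hc ((mul_comm _ _).trans (scalarCoeff_mul hπ heq x hy))
  have hpow : ∀ n : ℕ, scalarCoeff π (y⁻¹ ^ n) = scalarCoeff π 1 := by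
    intro n
    induction n with
    | zero => rw [pow_zero]
    | succ n ih => rw [pow_succ, ← div_eq_mul_inv, ← hdiv, ih]
  have hv : vec 1 0 ≠ 0 := fun h => one_ne_zero (congrFun h 0)
  have hinj : Function.Injective fun n : ℕ => y⁻¹ ^ n := by
    intro m n hmn
    refine (pow_right_injective₀ (a := |y⁻¹|) (abs_pos.2 (inv_ne_zero hy)) ?_) ?_
    · rw [abs_inv, Ne, inv_eq_one, abs_eq zero_le_one]
      exact not_or.2 ⟨h1, h2⟩
    · simpa only [abs_pow] using congrArg abs hmn
  have h := eq_zero_of_coeff_const (memLp_condChar π (vec 1 0))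
    (a := fun n : ℕ => (y⁻¹ ^ n) • vec 1 0) ((smul_left_injective ℚ hv).comp hinj) hpow
  rw [hdiv y, div_self hy] at hc
  exact hc h

theorem condChar_ae_eq (hinv : ∀ χ, π χ⁻¹ = π χ) {v : RatPlane} (hv : v ≠ 0) :
    condChar π v =ᵐ[haar] fun χ => scalarCoeff π 1 * (char v χ + char (-v) χ) := by
  classical
  have hint : ∀ v w : RatPlane, Integrable (fun χ => conj (char w χ) * char v χ) haar :=
    fun v w => ((memLp_char v 2).integrable one_le_two).bdd_mul
      (memLp_char w 2).star.aestronglyMeasurable (c := 1)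
      (ae_of_all _ fun χ => ((RCLike.norm_conj _).trans (norm_char w χ)).le)
  refine ae_eq_of_coeff_eq (memLp_condChar π v)
    (((memLp_char v 2).add (memLp_char (-v) 2)).const_mul _) fun w => ?_
  have hR : coeff (fun χ => scalarCoeff π 1 * (char v χ + char (-v) χ)) w =
      scalarCoeff π 1 * ((if w = v then 1 else 0) + if w = -v then 1 else 0) := by
    rw [← coeff_char, ← coeff_char, coeff, coeff, coeff, ← integral_add (hint _ _) (hint _ _),
      ← integral_const_mul]
    congr with χ
    ring
  have : IsAddTorsionFree RatPlane := inferInstanceAs (IsAddTorsionFree (Fin 2 → ℚ))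
  have hne : v ≠ -v := fun h => hv (self_eq_neg.1 h)
  have h1 : coeff (condChar π v) v = scalarCoeff π 1 := by
    rw [← coeff_condChar_smul_eq hπ heq hv, one_smul]
  rw [hR]
  by_cases hw1 : w = v
  · rw [hw1, if_pos rfl, if_neg hne, h1]; ring
  by_cases hw2 : w = -v
  · rw [hw2, if_pos rfl, if_neg hne.symm, coeff_condChar_neg hinv, h1]; ring
  rw [if_neg hw1, if_neg hw2, add_zero, mul_zero]
  -- Vanishing determinant means that `w` is a multiple `x • v`; here `x ≠ ±1`, so the coefficient
  -- is zero.
  by_cases hd : v 0 * w 1 - v 1 * w 0 = 0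
  · obtain ⟨x, rfl⟩ : ∃ x : ℚ, w = x • v := by
      by_cases h0 : v 0 = 0
      · have h1 : v 1 ≠ 0 := fun h1 => hv (ext_coord h0 h1)
        have hw0 : w 0 = 0 := by simpa [h0, h1] using hd
        refine ⟨w 1 / v 1, ext_coord ?_ ?_⟩ <;> rw [smul_coord]
        · rw [hw0, h0, mul_zero]
        · rw [div_mul_cancel₀ _ h1]
      · refine ⟨w 0 / v 0, ext_coord ?_ ?_⟩ <;> rw [smul_coord]
        · rw [div_mul_cancel₀ _ h0]
        · field_simp
          linear_combination hd
    rw [coeff_condChar_smul_eq hπ heq hv]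
    refine scalarCoeff_eq_zero hπ heq ?_ ?_
    · rintro rfl; exact hw1 (one_smul _ _)
    · rintro rfl; exact hw2 (by rw [neg_smul, one_smul])
  · exact coeff_condChar_eq_zero_of_det_ne_zero hπ heq hd

/-- The indicator of `π ⁻¹' B` is fixed by `E`, so its coefficient at `v ≠ 0` is its inner product
with `E(char v) = 0`. It is therefore a.e. constant. -/
theorem haar_preimage_eq_zero_or_one (hinv : ∀ χ, π χ⁻¹ = π χ) (h0 : scalarCoeff π 1 = 0)
    {B : Set Z} (hB : MeasurableSet B) :
    (∀ᵐ χ ∂haar, π χ ∈ B) ∨ ∀ᵐ χ ∂haar, π χ ∉ B := by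
  classical
  have hm : MeasurableSet (π ⁻¹' B) := hπ hB
  set f : DualRatPlane → ℂ := (π ⁻¹' B).indicator fun _ => (1 : ℂ) with hf
  have hf2 : MemLp f 2 haar := memLp_indicator_const 2 hm 1 (Or.inr (measure_ne_top _ _))
  have hcond : haar[f | mZ.comap π] = f :=
    condExp_of_stronglyMeasurable hπ.comap_le
      (stronglyMeasurable_const.indicator ⟨B, hB, rfl⟩) (hf2.integrable one_le_two)
  have hconst : f =ᵐ[haar] fun _ => coeff f 0 := by
    have hc2 : MemLp (fun _ : DualRatPlane => coeff f 0) 2 haar := memLp_const _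
    refine ae_eq_of_coeff_eq hf2 hc2 fun v => ?_
    have hR : coeff (fun _ => coeff f 0) v = coeff f 0 * ∫ χ, char (-v) χ ∂haar := by
      rw [coeff, ← integral_const_mul]
      congr with χ
      rw [conj_char, mul_comm]
    rw [hR]
    by_cases hv : v = 0
    · simp [hv, char_zero]
    · rw [integral_char (neg_ne_zero.2 hv), mul_zero, coeff, ← hcond,
        ← integral_conj_condExp_mul hπ.comap_le (memLp_char v 2) hf2]
      refine integral_eq_zero_of_ae ?_
      filter_upwards [condChar_ae_eq hπ heq hinv hv] with χ hχ
      change conj (condChar π v χ) * f χ = 0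
      rw [hχ, h0, zero_mul, map_zero, zero_mul]
  by_cases h : coeff f 0 = 0
  · right
    filter_upwards [hconst] with χ hχ hmem
    rw [h, hf, Set.indicator_of_mem (show χ ∈ π ⁻¹' B from hmem)] at hχ
    exact one_ne_zero hχ
  · left
    filter_upwards [hconst] with χ hχ
    by_contra hmem
    rw [hf, Set.indicator_of_notMem (show χ ∉ π ⁻¹' B from hmem)] at hχ
    exact h hχ.symm

theorem exists_re_char_ae_eq_comp (hinv : ∀ χ, π χ⁻¹ = π χ) (h0 : scalarCoeff π 1 ≠ 0)
    (v : RatPlane) :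
    ∃ h : Z → ℝ, Measurable h ∧ ∀ᵐ χ ∂haar, h (π χ) = (char v χ).re := by
  by_cases hv : v = 0
  · exact ⟨fun _ => 1, measurable_const, ae_of_all _ fun χ => by simp [hv, char_zero]⟩
  obtain ⟨h, hh, hhπ⟩ := exists_condChar_eq_comp π v
  -- Here `E(char v) = 2 s(1) Re (char v)`, and one divides by the nonzero constant.
  refine ⟨fun z => (h z / (scalarCoeff π 1 * 2)).re,
    Complex.measurable_re.comp (hh.measurable.div_const _), ?_⟩
  filter_upwards [condChar_ae_eq hπ heq hinv hv] with χ hχ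
  rw [hhπ, Function.comp_apply, ← conj_char, Complex.add_conj] at hχ
  rw [hχ, ofReal_mul, ofReal_ofNat, ← mul_assoc,
    mul_div_cancel_left₀ _ (mul_ne_zero h0 two_ne_zero), ofReal_re]

end Equivariant

end DualRatPlane

/-! ### Separation of points of `Y` and primeness -/

namespace FlipQuotient

open DualRatPlane

/-- The real parts of the values of a character, as a function on `Y`. -/
def rePairing : FlipQuotient → RatPlane → ℝ :=
  Quotient.lift (fun χ v => (char v χ).re) (by
    rintro φ ψ (rfl | h)
    · rfl
    · funext v
      rw [char_apply, char_apply, h, pairing_neg, Circle.coe_inv_eq_conj, conj_re])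

theorem continuous_rePairing_mk : Continuous (rePairing ∘ mk) :=
  continuous_pi fun v => continuous_re.comp (char v).continuous

/-- Equal real parts on the circle give `ψ(v) = χ(v)^{±1}` with a sign depending on `v`. The two
signs define subgroups covering `ℚ²`, and a group is not a union of two proper subgroups, so one
sign works throughout. -/
theorem injective_rePairing : Function.Injective rePairing := by
  intro y y' h
  obtain ⟨χ, rfl⟩ := mk_surjective y
  obtain ⟨ψ, rfl⟩ := mk_surjective y'
  have hv : ∀ v, ψ.pairing v = χ.pairing v ∨ ψ.pairing v = (χ⁻¹).pairing v := by
    intro v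
    have hre : (ψ.pairing v : ℂ).re = (χ.pairing v : ℂ).re := (congrFun h v).symm
    have n1 : ‖(ψ.pairing v : ℂ)‖ ^ 2 = 1 := by rw [Circle.norm_coe, one_pow]
    have n2 : ‖(χ.pairing v : ℂ)‖ ^ 2 = 1 := by rw [Circle.norm_coe, one_pow]
    rw [← normSq_eq_norm_sq, normSq_apply] at n1 n2
    have him : ((ψ.pairing v : ℂ).im - (χ.pairing v : ℂ).im) *
        ((ψ.pairing v : ℂ).im + (χ.pairing v : ℂ).im) = 0 := by
      rw [hre] at n1
      linear_combination n1 - n2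
    rcases mul_eq_zero.1 him with h1 | h1
    · exact Or.inl (Circle.coe_injective (Complex.ext hre (sub_eq_zero.1 h1)))
    · refine Or.inr (Circle.coe_injective (Complex.ext ?_ ?_)) <;>
        rw [pairing_inv_left, Circle.coe_inv_eq_conj]
      · rw [conj_re, hre]
      · rw [conj_im]
        exact eq_neg_of_add_eq_zero_left h1
  rw [mk_eq_mk]
  by_contra! hne
  obtain ⟨a, ha⟩ := not_forall.1 (mt pairing_ext hne.1)
  obtain ⟨b, hb⟩ := not_forall.1 (mt pairing_ext hne.2)
  have ha' := (hv a).resolve_left ha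
  have hb' := (hv b).resolve_right hb
  rcases hv (a + b) with hab | hab
  · rw [pairing_add, pairing_add, hb'] at hab
    exact ha (mul_right_cancel hab)
  · rw [pairing_add, pairing_add, ha'] at hab
    exact hb (mul_left_cancel hab)

/-- Measurability of images is tested upstairs on the Polish space `X`: a set is measurable within
the compact range once its preimage in `X` is. This avoids needing `Y` to be standard Borel in
advance. -/
theorem measurableEmbedding_rePairing : MeasurableEmbedding rePairing where
  injective := injective_rePairing
  measurable := fun _ hs => continuous_rePairing_mk.measurable hs
  measurableSet_image' := fun {s} hs => by
    have hr : Set.range (rePairing ∘ mk) = Set.range rePairing := mk_surjective.range_comp _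
    have h := (continuous_rePairing_mk.measurable.measurableSet_preimage_iff_inter_range
      (isCompact_range continuous_rePairing_mk).measurableSet (s := rePairing '' s)).1 (by
        rw [Set.preimage_comp, Set.preimage_image_eq _ injective_rePairing]
        exact hs)
    rwa [hr, Set.inter_eq_left.2 (Set.image_subset_range _ _)] at h

theorem isIsoModNull_of_re_char_ae_eq_comp {Z : Type*} [MeasurableSpace Z] [StandardBorelSpace Z]
    {ν : Measure Z} {p : FlipQuotient → Z} (hp : MeasurePreserving p measure ν)
    (H : ∀ v, ∃ h : Z → ℝ, Measurable h ∧ ∀ᵐ χ ∂haar, h (p (mk χ)) = (char v χ).re) :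
    IsIsoModNull measure ν p := by
  choose h hh hhp using H
  -- `r` is a measurable left inverse of `rePairing`; composed with the family `h` it gives the
  -- inverse of `p`.
  obtain ⟨r, hr, hrF⟩ := measurableEmbedding_rePairing.exists_measurable_extend
    measurable_id fun _ => ⟨mk 1⟩
  have hF : Measurable fun z v => h v z := measurable_pi_iff.2 hh
  have hF_ae : ∀ᵐ y ∂measure, (fun v => h v (p y)) = rePairing y := by
    refine (ae_map_iff measurable_mk.aemeasurable (measurableSet_eq_fun
      (hF.comp hp.measurable) measurableEmbedding_rePairing.measurable)).2 ?_
    filter_upwards [ae_all_iff.2 hhp] with χ hχ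
    exact funext hχ
  have hqp : ∀ᵐ y ∂measure, r (fun v => h v (p y)) = y := by
    filter_upwards [hF_ae] with y hy
    rw [hy]
    exact congrFun hrF y
  have hq : Measurable fun z => r fun v => h v z := hr.comp hF
  refine ⟨hp, fun z => r fun v => h v z, ⟨hq, ?_⟩, hqp, ?_⟩
  · rw [← hp.map_eq, Measure.map_map hq hp.measurable]
    exact (Measure.map_congr hqp).trans Measure.map_id
  · rw [← hp.map_eq]
    refine (ae_map_iff hp.measurable.aemeasurable
      (measurableSet_eq_fun (hp.measurable.comp hq) measurable_id)).2 ?_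
    filter_upwards [hqp] with y hy
    exact congrArg p hy

theorem ae_mk_smul {Z : Type*} [MulAction PSL(2, ℚ) Z] {p : FlipQuotient → Z} (γ : PSL(2, ℚ))
    (h : ∀ᵐ y ∂measure, p (γ • y) = γ • p y) :
    ∀ᵐ χ ∂haar, p (γ • mk χ) = γ • p (mk χ) :=
  ae_of_ae_map (p := fun y => p (γ • y) = γ • p y) measurable_mk.aemeasurable h

theorem isPrimeAction : IsPrimeAction.{u, 0, 0} PSL(2, ℚ) measure := by
  intro Z _ _ _ ν p hp
  have hmp : MeasurePreserving (fun χ => p (mk χ)) haar ν :=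
    hp.measurePreserving.comp measurePreserving_mk
  have hπ : Measurable fun χ => p (mk χ) := hmp.measurable
  have heq : ∀ g : SL(2, ℚ), ∃ φ : Z → Z, Measurable φ ∧
      ∀ᵐ χ ∂haar, p (mk (g • χ)) = φ (p (mk χ)) := by
    intro g
    have h1 := (hp.isPMPAction.measurePreserving (QuotientGroup.mk g)).measurable
    have h2 := ae_mk_smul _ (hp.equivariant (QuotientGroup.mk g))
    simp only [psl_smul_mk] at h2
    exact ⟨_, h1, h2⟩
  have hinv : ∀ χ, p (mk χ⁻¹) = p (mk χ) := fun χ =>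
    congrArg p (mk_eq_mk.2 (Or.inr (inv_inv χ).symm))
  have : Nonempty Z := ⟨p (mk 1)⟩
  by_cases h0 : scalarCoeff (fun χ => p (mk χ)) 1 = 0
  · left
    -- The zero-one law for all measurable sets forces an a.e. constant map, since countably many of
    -- them separate the points of `Z`.
    obtain ⟨z₀, hz₀⟩ := Filter.exists_eventuallyEq_const_of_forall_separating
      (f := fun χ => p (mk χ)) (l := ae haar) MeasurableSet
      fun U hU => haar_preimage_eq_zero_or_one hπ heq hinv h0 hU
    refine ⟨z₀, ?_⟩
    rw [← hmp.map_eq]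
    exact (ae_map_iff hπ.aemeasurable (measurableSet_singleton z₀)).2 hz₀
  · exact Or.inr (isIsoModNull_of_re_char_ae_eq_comp hp.measurePreserving
      (exists_re_char_ae_eq_comp hπ heq hinv h0))

end FlipQuotient

end

theorem mainTheorem8 :
    IsPMPAction PSL(2, ℚ) FlipQuotient.measure ∧
    IsFreeAction PSL(2, ℚ) FlipQuotient.measure ∧
    IsWeaklyMixingAction PSL(2, ℚ) FlipQuotient.measure ∧
    IsPrimeAction.{u, 0, 0} PSL(2, ℚ) FlipQuotient.measure :=
  ⟨FlipQuotient.isPMPAction, FlipQuotient.isFreeAction, FlipQuotient.isWeaklyMixingAction,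
    FlipQuotient.isPrimeAction⟩
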